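/- Let $A\in\mathbb{R}^{m\times n}$, $b\in\mathbb{R}^m$, $f(x)=\tfrac12\|Ax-b\|^2$, $\lambda>0$, $q\in[0,1)$ and $F(x)=f(x)+\lambda\|x\|_q^q$ on $\mathbb{R}^n$, where $\|x\|_q^q=\sum_i|x_i|^q$ if $q\in(0,1)$ and $\|x\|_0^0=\|x\|_0$ is the number of non-zero entries of $x$ if $q=0$. For an index set $T$ put $E(x;T)=f(x)+\lambda\|x_T\|_q^q$. For a function $g$, the generalized Hessian $\partial^2 g(x)$ is the convex hull of all limits of $\nabla^2 g(x^i)$ along sequences $x^i\to x$ of points where $g$ is twice differentiable. For $S=\mathrm{supp}(x)$, let $\partial^2_S E(x)$ be the set of principal submatrices, with rows and columns in $S$, of the elements of $\partial^2 E(\cdot;S)(x)$, and let $\nabla_S E(x)$ be the subvector of $\nabla E(\cdot;S)(x)$ indexed by $S$. The second-order sufficient condition at $x^*$, with $S^*=\mathrm{supp}(x^*)$, is $$\langle Mv,v\rangle>0\quad\text{for all } M\in\partial^2_{S^*}E(x^*)\text{ and all } 0\ne v\in\mathbb{R}^{|S^*|},$$ and $\sigma_*=\tfrac12\inf_{M\in\partial^2_{S^*}E(x^*)}\inf_{\|v\|=1}\langle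 Mv,v\rangle$ (with $\sigma_*=+\infty$ if $x^*=0$). The algorithm PSNP (proximal semismooth Newton pursuit) has parameters $\sigma>0$, $\gamma\in(0,1)$, $\tau>0$ and a constant step size $\alpha\in\left(0,\min\{\tau,\tfrac1{\sigma+\sigma_0}\}\right]$, where $\sigma_0$ is a constant such that $f(x)\le f(w)+\langle\nabla f(w),x-w\rangle+\tfrac{\sigma_0}{2}\|x-w\|^2$ for all $x,w$. From an arbitrary $x^0\in\mathbb{R}^n$ it does the following for $k=0,1,2,\dots$: (I) choose $w^k\in\operatorname{argmin}_{z}\ \tfrac12\|z-(x^k-\alpha\nabla f(x^k))\|^2+\alpha\lambda\|z\|_q^q$; (II) put $S^k=\mathrm{supp}(w^k)$; (III) choose $M^k\in\partial^2_{S^k}E(w^k)$. If the system $M^kd_{S^k}=\nabla_{S^k}E(w^k)$, $d_{\overline{S^k}}=0$ is solvable, let $d^k$ be a solution; if moreover there is an integer $s\ge0$ with $F(w^k-\gamma^{s}d^k)\le F(w^k)-\tfrac{\sigma}{2}\|\gamma^{s}d^k\|^2$, put $x^{k+1}=w^k-\gamma^{s_k}d^k$ for the smallest such integer $s_k$. In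 all other cases put $x^{k+1}=w^k$. **Statement.** Let $\{x^k\}$ be a sequence generated by PSNP and let $x^*$ be an accumulation point of it. If the second-order sufficient condition holds at $x^*$ and $\sigma\in(0,\sigma_*)$, then the whole sequence $\{x^k\}$ converges to $x^*$, and $x^*$ is a unique local minimizer of $F$, in the sense that there are $\eta>0$ and a neighbourhood $N$ of $x^*$ with $F(x)\ge F(x^*)+\eta\|x-x^*\|^2$ for all $x\in N$. Moreover: 1) if $q=0$, the sequence reaches $x^*$ after finitely many steps: there is $K$ with $x^k=x^*$ for all $k\ge K$; 2) if $q\in(0,1)$, the convergence is quadratic: there is a constant $C$ with $\|x^{k+1}-x^*\|\le C\|x^k-x^*\|^2$ for all sufficiently large $k$. -/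

import Mathlib

open Set Filter Topology

noncomputable section

/-- The Euclidean space `ℝⁿ`. -/
abbrev Euc (n : ℕ) : Type := EuclideanSpace ℝ (Fin n)

/-- The support set of a vector. -/
def supp {n : ℕ} (x : Euc n) : Finset (Fin n) := Finset.univ.filter fun i => x i ≠ 0

/-- `|t|^q` with the convention `|0|^0 = 0` (Mathlib has `0 ^ 0 = 1`), so that the case `q = 0`
counts non-zero entries. -/
def absPow (q t : ℝ) : ℝ := if t = 0 then 0 else |t| ^ q

/-- `‖x_T‖_q^q`, the sum of `|x_i|^q` over the index set `T`; the number of non-zero entries of `x`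
in `T` when `q = 0`. -/
def lqPowOn {n : ℕ} (q : ℝ) (T : Finset (Fin n)) (x : Euc n) : ℝ := ∑ i ∈ T, absPow q (x i)

/-- `‖x‖_q^q`. -/
def lqPow {n : ℕ} (q : ℝ) (x : Euc n) : ℝ := lqPowOn q Finset.univ x

/-- The objective `F = f + lam * ‖·‖_q^q`. -/
def objF {n : ℕ} (f : Euc n → ℝ) (lam q : ℝ) (x : Euc n) : ℝ := f x + lam * lqPow q x

/-- The function `E(·; T) = f + lam * ‖(·)_T‖_q^q`. -/
def objE {n : ℕ} (f : Euc n → ℝ) (lam q : ℝ) (T : Finset (Fin n)) (x : Euc n) : ℝ :=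
  f x + lam * lqPowOn q T x

/-- The proximal operator of `r`: all global minimizers of `½‖x - ·‖² + r`. -/
def prox {n : ℕ} (r : Euc n → ℝ) (x : Euc n) : Set (Euc n) :=
  {w | ∀ z : Euc n, 1 / 2 * ‖x - w‖ ^ 2 + r w ≤ 1 / 2 * ‖x - z‖ ^ 2 + r z}

/-- `f` is twice differentiable at `x`: it is differentiable around `x` and its gradient is
differentiable at `x`. -/
def TwiceDifferentiableAt {n : ℕ} (f : Euc n → ℝ) (x : Euc n) : Prop :=
  (∀ᶠ y in 𝓝 x, DifferentiableAt ℝ f y) ∧ DifferentiableAt ℝ (gradient f) x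

/-- The Hessian matrix, i.e. the Jacobian matrix of the gradient. -/
def hessian {n : ℕ} (f : Euc n → ℝ) (x : Euc n) : Matrix (Fin n) (Fin n) ℝ :=
  Matrix.of fun i j => (fderiv ℝ (gradient f) x (EuclideanSpace.single j 1)) i

/-- The generalized Hessian `∂²f(x)`: the convex hull of all limits of Hessians `∇²f(xⁱ)` along
sequences `xⁱ → x` of points at which `f` is twice differentiable. -/
def genHessian {n : ℕ} (f : Euc n → ℝ) (x : Euc n) : Set (Matrix (Fin n) (Fin n) ℝ) :=
  convexHull ℝ {H | ∃ u : ℕ → Euc n, Tendsto u atTop (𝓝 x) ∧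
    (∀ i, TwiceDifferentiableAt f (u i)) ∧ Tendsto (fun i => hessian f (u i)) atTop (𝓝 H)}

/-- `∂²_S f(x)`: the principal submatrices, with rows and columns in `S`, of the elements of
`∂²f(x)`. -/
def genHessianOn {n : ℕ} (f : Euc n → ℝ) (S : Finset (Fin n)) (x : Euc n) :
    Set (Matrix S S ℝ) :=
  (fun H => H.submatrix Subtype.val Subtype.val) '' genHessian f x

/-- `∂²_S E(x)` for `S = supp x`. -/
def genHessianE {n : ℕ} (f : Euc n → ℝ) (lam q : ℝ) (x : Euc n) :
    Set (Matrix (supp x) (supp x) ℝ) :=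
  genHessianOn (objE f lam q (supp x)) (supp x) x

/-- The second-order sufficient condition at `x`: every matrix in `∂²_S E(x)`, `S = supp x`, is
positive definite. -/
def SecondOrderSufficient {n : ℕ} (f : Euc n → ℝ) (lam q : ℝ) (x : Euc n) : Prop :=
  ∀ M ∈ genHessianE f lam q x, ∀ v : supp x → ℝ, v ≠ 0 → 0 < M.mulVec v ⬝ᵥ v

/-- `σ_* = ½ inf_M inf_{‖v‖ = 1} ⟨M v, v⟩`, with `M` in `∂²_S E(x)`, `S = supp x`. The infimum is
taken in the extended reals (it is `⊤` if `x = 0`). Here `v ⬝ᵥ v` is the squared Euclidean norm. -/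
def sigmaStar {n : ℕ} (f : Euc n → ℝ) (lam q : ℝ) (x : Euc n) : EReal :=
  ⨅ M ∈ genHessianE f lam q x, ⨅ v : {v : supp x → ℝ // v ⬝ᵥ v = 1},
    ((1 / 2 * (M.mulVec v.1 ⬝ᵥ v.1) : ℝ) : EReal)

/-- `L`-strong smoothness on the whole space. -/
def StronglySmooth {n : ℕ} (f : Euc n → ℝ) (L : ℝ) : Prop :=
  ∀ x w : Euc n, f x ≤ f w + inner ℝ (gradient f w) (x - w) + L / 2 * ‖x - w‖ ^ 2

/-- The Newton equations at `w` with `S = supp w`: `M d_S = ∇_S E(w; S)` and `d = 0` off `S`. -/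
def NewtonEq {n : ℕ} (f : Euc n → ℝ) (lam q : ℝ) (w : Euc n) (M : Matrix (supp w) (supp w) ℝ)
    (d : Euc n) : Prop :=
  (∀ i : supp w, M.mulVec (fun j : supp w => d j) i = gradient (objE f lam q (supp w)) w i) ∧
    ∀ i ∉ supp w, d i = 0

/-- The Armijo-type acceptance test for the step `γ ^ s` along `-d`. -/
def NewtonAccept {n : ℕ} (f : Euc n → ℝ) (lam q σ γ : ℝ) (w d : Euc n) (s : ℕ) : Prop :=
  objF f lam q (w - γ ^ s • d) ≤ objF f lam q w - σ / 2 * ‖γ ^ s • d‖ ^ 2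

/-- The semismooth Newton phase, leading from `w` to the next iterate `x'`: choose
`M ∈ ∂²_S E(w)`, `S = supp w`. If the Newton equations have no solution, then `x' = w`. Otherwise
take a solution `d`; if some `s` passes the acceptance test, then `x' = w - γ ^ s • d` for the
smallest such `s`, and `x' = w` if there is none. -/
def NewtonPhase {n : ℕ} (f : Euc n → ℝ) (lam q σ γ : ℝ) (w x' : Euc n) : Prop :=
  ∃ M ∈ genHessianE f lam q w,
    ((¬ ∃ d, NewtonEq f lam q w M d) ∧ x' = w) ∨
    ∃ d, NewtonEq f lam q w M d ∧
      ((∃ s, IsLeast {s | NewtonAccept f lam q σ γ w d s} s ∧ x' = w - γ ^ s • d) ∨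
        ((∀ s, ¬ NewtonAccept f lam q σ γ w d s) ∧ x' = w))

/-- `x`, `w` are the sequences of a run of PSNP with constant proximal step size `α`. The
proximal-phase test `F(wᵏ) ≤ F(xᵏ) - σ/2 ‖wᵏ - xᵏ‖²` on the step size is not imposed on the run:
nothing is assumed about descent, the step size is restricted only through its explicit upper bound
where runs are considered. -/
structure IsPSNPRun {n : ℕ} (f : Euc n → ℝ) (lam q σ γ α : ℝ) (x w : ℕ → Euc n) : Prop where
  proximal : ∀ k, w k ∈ prox (fun z => α * lam * lqPow q z) (x k - α • gradient f (x k))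
  newton : ∀ k, NewtonPhase f lam q σ γ (w k) (x (k + 1))

/-- The compressed-sensing objective `½‖A x - b‖²`. -/
def fcs {m n : ℕ} (A : Matrix (Fin m) (Fin n) ℝ) (b : Euc m) (x : Euc n) : ℝ :=
  1 / 2 * ‖A.toEuclideanLin x - b‖ ^ 2

end

/-! Where no coordinate in `S` vanishes, `E(·; S)` is smooth, and its generalized Hessian is the
ordinary one (`genHessian_objE`). Once the support is identified, the semismooth Newton phase is
therefore classical Newton.

The proximal phase identifies the support: the non-zero entries of its output are at least some `r >
0` that does not depend on the input (`exists_pos_le_abs_of_prox`), so every `wᵏ` close to `x*` has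
the support of `x*`. Both phases decrease `F` by at least `σ/2` times the squared step
(`prox_descent`, `NewtonPhase.descent`). As `F ≥ 0`, the steps vanish, and the proximal optimality
condition passes to the limit: `x*` is stationary on its support (`gradE_eq_zero_of_tendsto`).

With the definiteness supplied by `σ < σ_*`, `F` grows quadratically at `x*` (`objF_growth`): on the
support through the Hessian, off it because `|t|^q` beats every multiple of `|t|` near `0`. Growth
together with vanishing steps traps the whole sequence (`tendsto_of_mapClusterPt_of_growth`).

For the rate, full Newton steps are eventually accepted and `‖xᵏ⁺¹ - x*‖ ≤ C‖wᵏ - x*‖²`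
(`newtonPhase_contraction`). Here `C = 0` if `q = 0`, because the penalty is locally constant on the
support and the Newton model is exact. For `q > 0`, growth at `wᵏ`, descent, and the upper bound
`objF_upper` at `xᵏ` replace `wᵏ` by `xᵏ`. -/

/-! ### The scalar penalty `|t|^q`: derivatives, behaviour at zero, Taylor estimates. -/

theorem absPow_nonneg (q t : ℝ) : 0 ≤ absPow q t := by
  unfold absPow; split_ifs <;> positivity

theorem absPow_zero_right (q : ℝ) : absPow q 0 = 0 := by simp [absPow]

theorem absPow_of_ne {q t : ℝ} (ht : t ≠ 0) : absPow q t = |t| ^ q := by simp [absPow, ht]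

theorem absPow_eventuallyEq {t : ℝ} (q : ℝ) (ht : t ≠ 0) :
    absPow q =ᶠ[𝓝 t] fun s => |s| ^ q := by
  filter_upwards [isOpen_ne.mem_nhds ht] with s hs using absPow_of_ne hs

theorem absPow_contDiffAt {t : ℝ} (q : ℝ) (ht : t ≠ 0) : ContDiffAt ℝ 4 (absPow q) t :=
  ((contDiffAt_abs ht).rpow_const_of_ne (abs_ne_zero.2 ht)).congr_of_eventuallyEq
    (absPow_eventuallyEq q ht)

theorem ContDiffAt.deriv_of_add_one_le {f : ℝ → ℝ} {t : ℝ} {k n : WithTop ℕ∞}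
    (hf : ContDiffAt ℝ n f t) (h : k + 1 ≤ n) : ContDiffAt ℝ k (deriv f) t :=
  (hf.fderiv_right h).clm_apply contDiffAt_const

theorem deriv_absPow_contDiffAt {t : ℝ} (q : ℝ) (ht : t ≠ 0) :
    ContDiffAt ℝ 3 (deriv (absPow q)) t :=
  (absPow_contDiffAt q ht).deriv_of_add_one_le (by norm_num)

theorem deriv_deriv_absPow_contDiffAt {t : ℝ} (q : ℝ) (ht : t ≠ 0) :
    ContDiffAt ℝ 2 (deriv (deriv (absPow q))) t :=
  (deriv_absPow_contDiffAt q ht).deriv_of_add_one_le (by norm_num)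

theorem absPow_hasDerivAt {t : ℝ} (q : ℝ) (ht : t ≠ 0) :
    HasDerivAt (absPow q) (deriv (absPow q) t) t :=
  ((absPow_contDiffAt q ht).differentiableAt (by norm_num)).hasDerivAt

theorem deriv_absPow_hasDerivAt {t : ℝ} (q : ℝ) (ht : t ≠ 0) :
    HasDerivAt (deriv (absPow q)) (deriv (deriv (absPow q)) t) t :=
  ((deriv_absPow_contDiffAt q ht).differentiableAt (by norm_num)).hasDerivAt

theorem deriv_absPow_zero {t : ℝ} (ht : t ≠ 0) : deriv (absPow 0) t = 0 := by
  have h : absPow 0 =ᶠ[𝓝 t] fun _ => (1 : ℝ) := by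
    filter_upwards [absPow_eventuallyEq 0 ht] with s hs
    rw [hs, Real.rpow_zero]
  rw [h.deriv_eq, deriv_const]

theorem deriv_deriv_absPow_zero {t : ℝ} (ht : t ≠ 0) : deriv (deriv (absPow 0)) t = 0 := by
  have h : deriv (absPow 0) =ᶠ[𝓝 t] fun _ => (0 : ℝ) := by
    filter_upwards [isOpen_ne.mem_nhds ht] with s hs using deriv_absPow_zero hs
  rw [h.deriv_eq, deriv_const]

/-- Near the origin `|t|^q` dominates every multiple of `|t|`. -/
theorem mul_abs_le_absPow_eventually {q : ℝ} (hq1 : q < 1) (K : ℝ) :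
    ∀ᶠ t in 𝓝 (0 : ℝ), K * |t| ≤ absPow q t := by
  have hc : Tendsto (fun t : ℝ => K * |t| ^ (1 - q)) (𝓝 0) (𝓝 0) := by
    have h : ContinuousAt (fun t : ℝ => K * |t| ^ (1 - q)) 0 :=
      continuousAt_const.mul (continuous_abs.continuousAt.rpow_const (Or.inr (by linarith)))
    have h0 : (0 : ℝ) ^ (1 - q) = 0 := Real.zero_rpow (by linarith)
    simpa [ContinuousAt, h0] using h
  filter_upwards [hc.eventually_lt_const one_pos] with t ht
  rcases eq_or_ne t 0 with rfl | h0
  · simp [absPow]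
  · rw [absPow_of_ne h0]
    have hp : 0 < |t| := abs_pos.2 h0
    have e : |t| = |t| ^ (1 - q) * |t| ^ q := by
      rw [← Real.rpow_add hp]; simp
    calc K * |t| = (K * |t| ^ (1 - q)) * |t| ^ q := by rw [mul_assoc, ← e]
      _ ≤ 1 * |t| ^ q := by gcongr
      _ = _ := one_mul _

/-- The non-zero minimizers of `½(u - ·)² + c|·|^q` are bounded away from zero, uniformly in `u`. -/
theorem exists_pos_le_abs_of_scalar_prox {q c : ℝ} (hq1 : q < 1) (hc : 0 < c) :
    ∃ r > 0, ∀ u w : ℝ, w ≠ 0 →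
      (∀ t, 1 / 2 * (u - w) ^ 2 + c * absPow q w ≤ 1 / 2 * (u - t) ^ 2 + c * absPow q t) →
      r ≤ |w| := by
  have h2 : (2 : ℝ) ^ q < 2 := by
    simpa using Real.rpow_lt_rpow_of_exponent_lt (x := 2) (by norm_num) hq1
  have hpos : 0 < c * (2 - 2 ^ q) := mul_pos hc (by linarith)
  refine ⟨(c * (2 - 2 ^ q)) ^ (2 - q)⁻¹, by positivity, fun u w hw h => ?_⟩
  have hp : 0 < |w| := abs_pos.2 hw
  -- Adding the inequalities for the competitors `0` and `2w` cancels the term `u * w`, which leaves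
  -- `c (2 - 2^q) |w|^q ≤ w²` whatever `u` is.
  have e0 := h 0
  have e2 := h (2 * w)
  rw [absPow_of_ne (by simpa using hw : 2 * w ≠ 0), abs_mul, absPow_of_ne hw,
    Real.mul_rpow (by positivity) hp.le, abs_of_pos (two_pos : (0 : ℝ) < 2)] at e2
  rw [absPow_zero_right, absPow_of_ne hw] at e0
  have h3 : c * (2 - 2 ^ q) * |w| ^ q ≤ |w| ^ (2 - q) * |w| ^ q := by
    rw [← Real.rpow_add hp, sub_add_cancel, Real.rpow_two, sq_abs]
    nlinarith
  have h4 := le_of_mul_le_mul_right h3 (Real.rpow_pos_of_pos hp q)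
  have h5 : 0 ≤ (2 - q)⁻¹ := inv_nonneg.2 (by linarith)
  calc _ ≤ (|w| ^ (2 - q)) ^ (2 - q)⁻¹ := by gcongr
    _ = |w| := Real.rpow_rpow_inv hp.le (by linarith)

/-- A linear approximation estimate from a bound on the deviation of the derivative. -/
theorem abs_sub_sub_le_of_abs_deriv_sub_le {f f' : ℝ → ℝ} {s t c ε : ℝ}
    (hf : ∀ x ∈ uIcc t s, HasDerivAt f (f' x) x) (hb : ∀ x ∈ uIcc t s, |f' x - c| ≤ ε) :
    |f s - f t - c * (s - t)| ≤ ε * |s - t| := by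
  have h := (convex_uIcc t s).norm_image_sub_le_of_norm_hasDerivWithin_le
    (f := fun x => f x - c * x) (f' := fun x => f' x - c) (C := ε)
    (fun x hx => by
      have := ((hf x hx).sub ((hasDerivAt_id x).const_mul c)).hasDerivWithinAt (s := uIcc t s)
      rwa [mul_one] at this)
    hb left_mem_uIcc right_mem_uIcc
  rw [Real.norm_eq_abs, Real.norm_eq_abs] at h
  convert h using 2
  ring

theorem eventually_uIcc_of_eventually {a : ℝ} {p : ℝ → Prop} (h : ∀ᶠ x in 𝓝 a, p x) :
    ∀ᶠ y : ℝ × ℝ in 𝓝 (a, a), ∀ x ∈ uIcc y.1 y.2, p x := by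
  obtain ⟨r, hr, hp⟩ := Metric.eventually_nhds_iff_ball.1 h
  have hb : Metric.ball a r ∈ 𝓝 a := Metric.ball_mem_nhds a hr
  rw [nhds_prod_eq]
  filter_upwards [prod_mem_prod hb hb] with y hy x hx
  refine hp x ?_
  have := (convex_ball a r).segment_subset hy.1 hy.2
  rw [segment_eq_uIcc] at this
  exact this hx

/-- Both endpoints move while the second derivative stays frozen at `a`: the Newton acceptance test
compares two points near the limit, neither of which is the limit. -/
theorem absPow_taylor_two {a ε : ℝ} (q : ℝ) (ha : a ≠ 0) (hε : 0 < ε) :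
    ∀ᶠ y : ℝ × ℝ in 𝓝 (a, a),
      |absPow q y.2 - absPow q y.1 - deriv (absPow q) y.1 * (y.2 - y.1)
        - 1 / 2 * deriv (deriv (absPow q)) a * (y.2 - y.1) ^ 2| ≤ ε * (y.2 - y.1) ^ 2 := by
  have hc : Tendsto (deriv (deriv (absPow q))) (𝓝 a) (𝓝 (deriv (deriv (absPow q)) a)) :=
    (deriv_deriv_absPow_contDiffAt q ha).continuousAt
  have h1 : ∀ᶠ x in 𝓝 a, x ≠ 0 ∧ |deriv (deriv (absPow q)) x - deriv (deriv (absPow q)) a| ≤ ε := by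
    filter_upwards [isOpen_ne.mem_nhds ha, Metric.tendsto_nhds.1 hc ε hε] with x hx hx'
    exact ⟨hx, by rw [← Real.dist_eq]; exact hx'.le⟩
  filter_upwards [eventually_uIcc_of_eventually h1] with ⟨t, s⟩ h
  dsimp only at h ⊢
  set c := deriv (deriv (absPow q)) a
  -- The mean value estimate is used twice: here for the derivative, then for the function with its
  -- quadratic term `c/2 (x - t)²` removed.
  have key : ∀ x ∈ uIcc t s,
      |deriv (absPow q) x - deriv (absPow q) t - c * (x - t)| ≤ ε * |x - t| := by
    intro x hx
    have hsub : uIcc t x ⊆ uIcc t s := uIcc_subset_uIcc_left hx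
    exact abs_sub_sub_le_of_abs_deriv_sub_le
      (fun z hz => deriv_absPow_hasDerivAt q (h z (hsub hz)).1) fun z hz => (h z (hsub hz)).2
  have h2 := abs_sub_sub_le_of_abs_deriv_sub_le (s := s) (t := t)
    (f := fun x => absPow q x - 1 / 2 * c * (x - t) ^ 2)
    (f' := fun x => deriv (absPow q) x - c * (x - t)) (c := deriv (absPow q) t)
    (ε := ε * |s - t|)
    (fun x hx => by
      have := (absPow_hasDerivAt q (h x hx).1).sub
        (((((hasDerivAt_id x).sub_const t).pow 2)).const_mul (1 / 2 * c))
      refine this.congr_deriv ?_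
      simp
      ring)
    (fun x hx => by
      have h3 := key x hx
      have h4 : |x - t| ≤ |s - t| := abs_sub_left_of_mem_uIcc hx
      rw [sub_right_comm]
      exact h3.trans (by gcongr))
  rw [mul_assoc ε, abs_mul_abs_self, ← sq] at h2
  convert h2 using 2
  simp only [sub_self]
  ring

/-- The error of the Newton model of the derivative is quadratic; there is none if `q = 0`. -/
theorem deriv_absPow_newton_error {a : ℝ} (q : ℝ) (ha : a ≠ 0) :
    ∃ C ≥ 0, (q = 0 → C = 0) ∧ ∀ᶠ t in 𝓝 a,
      |deriv (deriv (absPow q)) t * (t - a) - (deriv (absPow q) t - deriv (absPow q) a)|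
        ≤ C * (t - a) ^ 2 := by
  rcases eq_or_ne q 0 with rfl | hq
  · refine ⟨0, le_rfl, fun _ => rfl, ?_⟩
    filter_upwards [isOpen_ne.mem_nhds ha] with t ht
    simp [deriv_absPow_zero ht, deriv_absPow_zero ha, deriv_deriv_absPow_zero ht]
  · obtain ⟨C, s, hs, hL⟩ :=
      ((deriv_deriv_absPow_contDiffAt q ha).of_le (by norm_num : (1 : WithTop ℕ∞) ≤ 2)).exists_lipschitzOnWith
    refine ⟨C, C.2, fun h => absurd h hq, ?_⟩
    have h1 : ∀ᶠ x in 𝓝 a, x ≠ 0 ∧ x ∈ s := (isOpen_ne.eventually_mem ha).and hs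
    have h2 : Tendsto (fun t : ℝ => (t, a)) (𝓝 a) (𝓝 (a, a)) :=
      (continuous_id.prodMk continuous_const).tendsto a
    filter_upwards [h2.eventually (eventually_uIcc_of_eventually h1)] with t h
    -- The linearization is based at the moving point `t` and evaluated at `a`; the Lipschitz bound
    -- on the second derivative supplies the second factor `|a - t|`.
    have h3 := abs_sub_sub_le_of_abs_deriv_sub_le (s := a) (t := t) (f := deriv (absPow q))
      (f' := deriv (deriv (absPow q))) (c := deriv (deriv (absPow q)) t) (ε := C * |a - t|)
      (fun x hx => deriv_absPow_hasDerivAt q (h x hx).1)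
      (fun x hx => by
        have h4 : |x - t| ≤ |a - t| := abs_sub_left_of_mem_uIcc hx
        have h5 := hL.dist_le_mul x (h x hx).2 t (h t left_mem_uIcc).2
        rw [Real.dist_eq, Real.dist_eq] at h5
        exact h5.trans (by gcongr))
    rw [mul_assoc, abs_mul_abs_self, ← sq] at h3
    calc _ = |deriv (absPow q) a - deriv (absPow q) t - deriv (deriv (absPow q)) t * (a - t)| := by
          congr 1; ring
      _ ≤ _ := h3
      _ = _ := by ring

/-! ### Gradient and Hessian of `E(·; T)` at points with no zero coordinate in `T`. -/

noncomputable section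

/-- The continuous linear map `x ↦ A x`. -/
def matCLM {m n : ℕ} (A : Matrix (Fin m) (Fin n) ℝ) : Euc n →L[ℝ] Euc m :=
  LinearMap.toContinuousLinearMap A.toEuclideanLin

/-- The gradient of `fcs A b`. -/
def fcsGrad {m n : ℕ} (A : Matrix (Fin m) (Fin n) ℝ) (b : Euc m) (y : Euc n) : Euc n :=
  (matCLM A).adjoint (matCLM A y - b)

/-- The gradient of `E(·; T)` at points whose coordinates in `T` do not vanish. -/
def gradE {m n : ℕ} (A : Matrix (Fin m) (Fin n) ℝ) (b : Euc m) (lam q : ℝ) (T : Finset (Fin n))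
    (y : Euc n) : Euc n :=
  fcsGrad A b y + ∑ i ∈ T, (lam * deriv (absPow q) (y i)) • EuclideanSpace.single i (1 : ℝ)

/-- The Hessian operator of `E(·; T)` at points whose coordinates in `T` do not vanish. -/
def hessE {m n : ℕ} (A : Matrix (Fin m) (Fin n) ℝ) (lam q : ℝ) (T : Finset (Fin n))
    (y : Euc n) : Euc n →L[ℝ] Euc n :=
  (matCLM A).adjoint ∘L matCLM A + ∑ i ∈ T, (lam * deriv (deriv (absPow q)) (y i)) •
    (EuclideanSpace.proj i : Euc n →L[ℝ] ℝ).smulRight (EuclideanSpace.single i (1 : ℝ))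

end

section

variable {m n : ℕ} (A : Matrix (Fin m) (Fin n) ℝ) (b : Euc m) (lam q : ℝ) (T : Finset (Fin n))

theorem fcs_eq (y : Euc n) : fcs A b y = 1 / 2 * ‖matCLM A y - b‖ ^ 2 := rfl

theorem fcs_nonneg (y : Euc n) : 0 ≤ fcs A b y := by
  rw [fcs_eq]; positivity

theorem fcs_expand (w y : Euc n) :
    fcs A b y = fcs A b w + inner ℝ (fcsGrad A b w) (y - w) + 1 / 2 * ‖matCLM A (y - w)‖ ^ 2 := by
  have e : matCLM A y - b = (matCLM A w - b) + matCLM A (y - w) := by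
    rw [map_sub]; abel
  rw [fcs_eq, fcs_eq, e, norm_add_sq_real, fcsGrad, ContinuousLinearMap.adjoint_inner_left]
  ring

theorem fcs_hasGradientAt (y : Euc n) : HasGradientAt (fcs A b) (fcsGrad A b y) y := by
  rw [hasGradientAt_iff_hasFDerivAt]
  have h := ((((matCLM A).hasFDerivAt (x := y)).sub_const b).norm_sq).const_mul (1 / 2 : ℝ)
  refine (h.congr_of_eventuallyEq (.of_forall fun z => fcs_eq A b z)).congr_fderiv ?_
  ext v
  simp [fcsGrad, ContinuousLinearMap.adjoint_inner_left]

theorem gradient_fcs (y : Euc n) : gradient (fcs A b) y = fcsGrad A b y :=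
  (fcs_hasGradientAt A b y).gradient

theorem fcsGrad_hasFDerivAt (y : Euc n) :
    HasFDerivAt (fcsGrad A b) ((matCLM A).adjoint ∘L matCLM A) y :=
  (matCLM A).adjoint.hasFDerivAt.comp y ((matCLM A).hasFDerivAt.sub_const b)

theorem continuous_fcsGrad : Continuous (fcsGrad A b) :=
  (matCLM A).adjoint.continuous.comp ((matCLM A).continuous.sub continuous_const)

theorem coord_hasFDerivAt (i : Fin n) (y : Euc n) :
    HasFDerivAt (fun z : Euc n => z i) (EuclideanSpace.proj i : Euc n →L[ℝ] ℝ) y :=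
  (EuclideanSpace.proj i : Euc n →L[ℝ] ℝ).hasFDerivAt

theorem tendsto_coord (i : Fin n) (y : Euc n) : Tendsto (fun z : Euc n => z i) (𝓝 y) (𝓝 (y i)) :=
  (EuclideanSpace.proj i : Euc n →L[ℝ] ℝ).continuous.tendsto y

variable {T} {y : Euc n}

theorem objE_hasGradientAt (hy : ∀ i ∈ T, y i ≠ 0) :
    HasGradientAt (objE (fcs A b) lam q T) (gradE A b lam q T y) y := by
  rw [hasGradientAt_iff_hasFDerivAt]
  have h1 : HasFDerivAt (fun z : Euc n => lqPowOn q T z)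
      (∑ i ∈ T, deriv (absPow q) (y i) • (EuclideanSpace.proj i : Euc n →L[ℝ] ℝ)) y :=
    HasFDerivAt.fun_sum fun i hi =>
      HasDerivAt.comp_hasFDerivAt (f := fun z : Euc n => z i) y (absPow_hasDerivAt q (hy i hi))
        (coord_hasFDerivAt i y)
  refine ((fcs_hasGradientAt A b y).hasFDerivAt.add (h1.const_mul lam)).congr_fderiv ?_
  ext v
  simp [gradE, EuclideanSpace.inner_single_left, Finset.mul_sum, mul_assoc]

theorem gradE_hasFDerivAt (hy : ∀ i ∈ T, y i ≠ 0) :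
    HasFDerivAt (gradE A b lam q T) (hessE A lam q T y) y := by
  refine (fcsGrad_hasFDerivAt A b y).add (HasFDerivAt.fun_sum fun i hi => ?_)
  have h1 := (((deriv_absPow_hasDerivAt q (hy i hi)).comp_hasFDerivAt y
    (coord_hasFDerivAt i y)).const_mul lam).smul_const (EuclideanSpace.single i (1 : ℝ))
  refine h1.congr_fderiv ?_
  ext v
  simp [mul_assoc]

theorem eventually_coord_ne_zero (hy : ∀ i ∈ T, y i ≠ 0) :
    ∀ᶠ z in 𝓝 y, ∀ i ∈ T, z i ≠ 0 := by
  rw [Filter.eventually_all_finset]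
  exact fun i hi => (tendsto_coord i y).eventually_ne (hy i hi)

theorem gradient_objE_eventuallyEq (hy : ∀ i ∈ T, y i ≠ 0) :
    gradient (objE (fcs A b) lam q T) =ᶠ[𝓝 y] gradE A b lam q T := by
  filter_upwards [eventually_coord_ne_zero hy] with z hz using
    (objE_hasGradientAt A b lam q hz).gradient

theorem fderiv_gradient_objE (hy : ∀ i ∈ T, y i ≠ 0) :
    fderiv ℝ (gradient (objE (fcs A b) lam q T)) y = hessE A lam q T y := by
  rw [(gradient_objE_eventuallyEq A b lam q hy).fderiv_eq]
  exact (gradE_hasFDerivAt A b lam q hy).fderiv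

theorem objE_twiceDifferentiableAt (hy : ∀ i ∈ T, y i ≠ 0) :
    TwiceDifferentiableAt (objE (fcs A b) lam q T) y := by
  refine ⟨?_, ?_⟩
  · filter_upwards [eventually_coord_ne_zero hy] with z hz using
      (objE_hasGradientAt A b lam q hz).differentiableAt
  · exact ((gradE_hasFDerivAt A b lam q hy).congr_of_eventuallyEq
      (gradient_objE_eventuallyEq A b lam q hy)).differentiableAt

theorem tendsto_hessE (hy : ∀ i ∈ T, y i ≠ 0) :
    Tendsto (hessE A lam q T) (𝓝 y) (𝓝 (hessE A lam q T y)) := by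
  refine tendsto_const_nhds.add (tendsto_finsetSum _ fun i hi => Tendsto.smul_const ?_ _)
  exact (((deriv_deriv_absPow_contDiffAt q (hy i hi)).continuousAt.tendsto.comp
    (tendsto_coord i y)).const_mul lam)

theorem hessian_objE (hy : ∀ i ∈ T, y i ≠ 0) :
    hessian (objE (fcs A b) lam q T) y =
      Matrix.of fun i j => (hessE A lam q T y (EuclideanSpace.single j 1)) i := by
  rw [hessian, fderiv_gradient_objE A b lam q hy]

/-- The Hessian is continuous at `y`, so every limit of Hessians equals its value there; the
constant sequence shows that this value is attained. -/
theorem genHessian_objE (hy : ∀ i ∈ T, y i ≠ 0) :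
    genHessian (objE (fcs A b) lam q T) y = {hessian (objE (fcs A b) lam q T) y} := by
  have hc : Tendsto (hessian (objE (fcs A b) lam q T)) (𝓝 y)
      (𝓝 (hessian (objE (fcs A b) lam q T) y)) := by
    have h1 : Tendsto (fun z => (Matrix.of fun i j =>
        (hessE A lam q T z (EuclideanSpace.single j 1)) i : Matrix (Fin n) (Fin n) ℝ)) (𝓝 y)
        (𝓝 (hessian (objE (fcs A b) lam q T) y)) := by
      rw [hessian_objE A b lam q hy]
      refine tendsto_pi_nhds.2 fun i => tendsto_pi_nhds.2 fun j => ?_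
      exact (tendsto_coord i _).comp (((ContinuousLinearMap.apply ℝ (Euc n) (EuclideanSpace.single j (1 : ℝ))).continuous.tendsto
        _).comp (tendsto_hessE A lam q hy))
    refine h1.congr' ?_
    filter_upwards [eventually_coord_ne_zero hy] with z hz using (hessian_objE A b lam q hz).symm
  rw [genHessian, ← convexHull_singleton (𝕜 := ℝ) (hessian (objE (fcs A b) lam q T) y)]
  congr 1
  ext H
  simp only [mem_ofPred_eq, mem_singleton_iff]
  constructor
  · rintro ⟨u, hu, -, hH⟩
    exact tendsto_nhds_unique hH (hc.comp hu)
  · rintro rfl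
    exact ⟨fun _ => y, tendsto_const_nhds, fun _ => objE_twiceDifferentiableAt A b lam q hy,
      tendsto_const_nhds⟩

theorem mem_supp {x : Euc n} {i : Fin n} : i ∈ supp x ↔ x i ≠ 0 := by simp [supp]

theorem ne_zero_of_mem_supp {x : Euc n} : ∀ i ∈ supp x, x i ≠ 0 := fun _ h => mem_supp.1 h

theorem genHessianE_fcs (x : Euc n) :
    genHessianE (fcs A b) lam q x =
      {(hessian (objE (fcs A b) lam q (supp x)) x).submatrix Subtype.val Subtype.val} := by
  rw [genHessianE, genHessianOn, genHessian_objE A b lam q ne_zero_of_mem_supp, image_singleton]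

/-- Replaces matrices indexed by `S` with operators on the whole space acting on vectors supported
in `S`, so that later arguments need no subtypes. -/
theorem hessian_submatrix_mulVec {S : Finset (Fin n)} (hy : ∀ i ∈ S, y i ≠ 0) {d : Euc n}
    (hd : ∀ i ∉ S, d i = 0) (i : S) :
    ((hessian (objE (fcs A b) lam q S) y).submatrix Subtype.val Subtype.val : Matrix S S ℝ).mulVec
      (fun j : S => d j) i = hessE A lam q S y d i := by
  have e : d = ∑ j : S, d j • EuclideanSpace.single (j : Fin n) (1 : ℝ) := by
    ext k
    by_cases hk : k ∈ S
    · rw [Finset.sum_coe_sort S (fun j => d j • EuclideanSpace.single (j : Fin n) (1 : ℝ))]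
      simp [hk, Pi.single_apply]
    · rw [Finset.sum_coe_sort S (fun j => d j • EuclideanSpace.single (j : Fin n) (1 : ℝ))]
      simp [hk, hd k hk, Pi.single_apply]
  conv_rhs => rw [e, map_sum]
  rw [hessian_objE A b lam q hy]
  simp [Matrix.mulVec, dotProduct, mul_comm]

theorem inner_eq_sum_of_supported {S : Finset (Fin n)} (u : Euc n) {d : Euc n}
    (hd : ∀ i ∉ S, d i = 0) : inner ℝ u d = ∑ i : S, u i * d i := by
  rw [Finset.sum_coe_sort S (fun j => u j * d j), PiLp.inner_apply]
  refine (Finset.sum_subset (Finset.subset_univ S) fun i _ hi => by simp [hd i hi]).symm.trans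
    (Finset.sum_congr rfl fun i _ => by simp [mul_comm])

theorem hessE_apply (v : Euc n) :
    hessE A lam q T y v = (matCLM A).adjoint (matCLM A v) +
      ∑ i ∈ T, (lam * deriv (deriv (absPow q)) (y i) * v i) • EuclideanSpace.single i (1 : ℝ) := by
  simp [hessE, smul_smul]

theorem inner_hessE (u v : Euc n) :
    inner ℝ (hessE A lam q T y u) v = inner ℝ (matCLM A u) (matCLM A v) +
      ∑ i ∈ T, lam * deriv (deriv (absPow q)) (y i) * u i * v i := by
  rw [hessE_apply, inner_add_left, ContinuousLinearMap.adjoint_inner_left, sum_inner]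
  simp [inner_smul_left, EuclideanSpace.inner_single_left]

theorem inner_gradE (v : Euc n) :
    inner ℝ (gradE A b lam q T y) v = inner ℝ (fcsGrad A b y) v +
      ∑ i ∈ T, lam * deriv (absPow q) (y i) * v i := by
  rw [gradE, inner_add_left, sum_inner]
  simp [inner_smul_left, EuclideanSpace.inner_single_left]

theorem gradE_apply_of_mem {i : Fin n} (hi : i ∈ T) :
    gradE A b lam q T y i = fcsGrad A b y i + lam * deriv (absPow q) (y i) := by
  simp [gradE, hi, Pi.single_apply]

end

/-! ### Second-order expansions of `E`, uniform definiteness and quadratic growth. -/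

section

variable {m n : ℕ} (A : Matrix (Fin m) (Fin n) ℝ) (b : Euc m) (lam q : ℝ)

theorem objE_sub (T : Finset (Fin n)) (w y : Euc n) :
    objE (fcs A b) lam q T y - objE (fcs A b) lam q T w =
      inner ℝ (fcsGrad A b w) (y - w) + 1 / 2 * ‖matCLM A (y - w)‖ ^ 2 +
        ∑ i ∈ T, lam * (absPow q (y i) - absPow q (w i)) := by
  rw [objE, objE, fcs_expand A b w y, lqPowOn, lqPowOn, ← Finset.mul_sum, Finset.sum_sub_distrib]
  ring

theorem sum_sq_coord_le (T : Finset (Fin n)) (h : Euc n) : ∑ i ∈ T, h i ^ 2 ≤ ‖h‖ ^ 2 := by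
  rw [EuclideanSpace.real_norm_sq_eq]
  exact Finset.sum_le_sum_of_subset_of_nonneg (Finset.subset_univ _) fun _ _ _ => sq_nonneg _

/-- A second-order expansion of `E(·; T)` with the Hessian frozen at `y`, uniformly near `y`. -/
theorem objE_taylor_two {T : Finset (Fin n)} {y : Euc n} (hy : ∀ i ∈ T, y i ≠ 0) (hlam : 0 < lam)
    {ε : ℝ} (hε : 0 < ε) :
    ∀ᶠ p : Euc n × Euc n in 𝓝 (y, y),
      |objE (fcs A b) lam q T p.2 - objE (fcs A b) lam q T p.1
        - inner ℝ (gradE A b lam q T p.1) (p.2 - p.1)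
        - 1 / 2 * inner ℝ (hessE A lam q T y (p.2 - p.1)) (p.2 - p.1)| ≤ ε * ‖p.2 - p.1‖ ^ 2 := by
  have h : ∀ᶠ p : Euc n × Euc n in 𝓝 (y, y), ∀ i ∈ T,
      |absPow q (p.2 i) - absPow q (p.1 i) - deriv (absPow q) (p.1 i) * (p.2 i - p.1 i)
        - 1 / 2 * deriv (deriv (absPow q)) (y i) * (p.2 i - p.1 i) ^ 2|
        ≤ ε / lam * (p.2 i - p.1 i) ^ 2 := by
    rw [Filter.eventually_all_finset]
    intro i hi
    have ht : Tendsto (fun p : Euc n × Euc n => (p.1 i, p.2 i)) (𝓝 (y, y)) (𝓝 (y i, y i)) := by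
      rw [nhds_prod_eq, nhds_prod_eq]
      exact (tendsto_coord i y).prodMap (tendsto_coord i y)
    exact ht.eventually (absPow_taylor_two q (hy i hi) (div_pos hε hlam))
  filter_upwards [h] with p hp
  have e : objE (fcs A b) lam q T p.2 - objE (fcs A b) lam q T p.1
        - inner ℝ (gradE A b lam q T p.1) (p.2 - p.1)
        - 1 / 2 * inner ℝ (hessE A lam q T y (p.2 - p.1)) (p.2 - p.1) =
      ∑ i ∈ T, lam * (absPow q (p.2 i) - absPow q (p.1 i)
        - deriv (absPow q) (p.1 i) * (p.2 i - p.1 i)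
        - 1 / 2 * deriv (deriv (absPow q)) (y i) * (p.2 i - p.1 i) ^ 2) := by
    rw [objE_sub, inner_gradE, inner_hessE, real_inner_self_eq_norm_sq]
    simp only [PiLp.sub_apply]
    have e1 : ∑ i ∈ T, lam * (absPow q (p.2 i) - absPow q (p.1 i)
        - deriv (absPow q) (p.1 i) * (p.2 i - p.1 i)
        - 1 / 2 * deriv (deriv (absPow q)) (y i) * (p.2 i - p.1 i) ^ 2) =
        ∑ i ∈ T, lam * (absPow q (p.2 i) - absPow q (p.1 i))
        - ∑ i ∈ T, lam * deriv (absPow q) (p.1 i) * (p.2 i - p.1 i)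
        - 1 / 2 * ∑ i ∈ T, lam * deriv (deriv (absPow q)) (y i) * (p.2 i - p.1 i)
          * (p.2 i - p.1 i) := by
      rw [Finset.mul_sum, ← Finset.sum_sub_distrib, ← Finset.sum_sub_distrib]
      exact Finset.sum_congr rfl fun i _ => by ring
    rw [e1]
    ring
  rw [e]
  calc _ ≤ ∑ i ∈ T, |lam * (absPow q (p.2 i) - absPow q (p.1 i)
        - deriv (absPow q) (p.1 i) * (p.2 i - p.1 i)
        - 1 / 2 * deriv (deriv (absPow q)) (y i) * (p.2 i - p.1 i) ^ 2)| :=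
        Finset.abs_sum_le_sum_abs _ _
    _ ≤ ∑ i ∈ T, ε * (p.2 - p.1) i ^ 2 := by
        refine Finset.sum_le_sum fun i hi => ?_
        rw [abs_mul, abs_of_pos hlam]
        calc _ ≤ lam * (ε / lam * (p.2 i - p.1 i) ^ 2) := by gcongr; exact hp i hi
          _ = _ := by rw [PiLp.sub_apply]; field_simp
    _ ≤ _ := by
        rw [← Finset.mul_sum]
        gcongr
        exact sum_sq_coord_le T _

/-- The error of the Newton model of `∇E(·; T)` is quadratic; there is none if `q = 0`. -/
theorem gradE_newton_error {T : Finset (Fin n)} {y : Euc n} (hy : ∀ i ∈ T, y i ≠ 0)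
    (hlam : 0 < lam) :
    ∃ C ≥ 0, (q = 0 → C = 0) ∧ ∀ᶠ w in 𝓝 y,
      ‖(hessE A lam q T w (w - y)) - (gradE A b lam q T w - gradE A b lam q T y)‖
        ≤ C * ‖w - y‖ ^ 2 := by
  have h := fun i : T => deriv_absPow_newton_error q (hy i i.2)
  choose C hC0 hCq hC using h
  refine ⟨∑ i, lam * C i, Finset.sum_nonneg fun i _ => mul_nonneg hlam.le (hC0 i),
    fun hq => Finset.sum_eq_zero fun i _ => by rw [hCq i hq, mul_zero], ?_⟩
  have h2 := Filter.eventually_all.2 fun i : T => (tendsto_coord (i : Fin n) y).eventually (hC i)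
  filter_upwards [h2] with w hw
  have e : hessE A lam q T w (w - y) - (gradE A b lam q T w - gradE A b lam q T y) =
      ∑ i : T, (lam * (deriv (deriv (absPow q)) (w i) * (w i - y i) -
        (deriv (absPow q) (w i) - deriv (absPow q) (y i)))) •
          EuclideanSpace.single (i : Fin n) (1 : ℝ) := by
    rw [Finset.sum_coe_sort T (fun i => (lam * (deriv (deriv (absPow q)) (w i) * (w i - y i) -
        (deriv (absPow q) (w i) - deriv (absPow q) (y i)))) •
          EuclideanSpace.single (i : Fin n) (1 : ℝ)), hessE_apply, gradE, gradE, fcsGrad, fcsGrad]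
    simp only [map_sub, mul_sub, sub_smul, Finset.sum_sub_distrib, PiLp.sub_apply, mul_assoc]
    abel
  rw [e, Finset.sum_mul]
  refine (norm_sum_le _ _).trans (Finset.sum_le_sum fun i _ => ?_)
  rw [norm_smul, PiLp.norm_single, norm_one, mul_one, Real.norm_eq_abs, abs_mul,
    abs_of_pos hlam, mul_assoc]
  have h3 : (w i - y i) ^ 2 ≤ ‖w - y‖ ^ 2 := by
    simpa using sum_sq_coord_le {(i : Fin n)} (w - y)
  have h4 := hC0 i
  gcongr
  exact (hw i).trans (by gcongr)

/-- Operator-norm continuity of the Hessian makes the neighbourhood of `y` independent of the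
direction `h`. -/
theorem abs_inner_hessE_sub_eventually_le {T : Finset (Fin n)} {y : Euc n} (hy : ∀ i ∈ T, y i ≠ 0)
    {ε : ℝ} (hε : 0 < ε) :
    ∀ᶠ w in 𝓝 y, ∀ h, |inner ℝ (hessE A lam q T w h) h - inner ℝ (hessE A lam q T y h) h|
      ≤ ε * ‖h‖ ^ 2 := by
  filter_upwards [Metric.tendsto_nhds.1 (tendsto_hessE A lam q hy) ε hε] with w hw h
  rw [dist_eq_norm] at hw
  rw [← inner_sub_left, ← sub_apply, sq, ← mul_assoc]
  exact (abs_real_inner_le_norm _ _).trans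
    (by gcongr; exact ContinuousLinearMap.le_of_opNorm_le _ hw.le h)

/-- `σ < σ_*` gives uniform positive definiteness of the Hessian on the support. -/
theorem exists_lt_forall_le_inner_hessE {σ : ℝ} {x : Euc n}
    (h : (σ : EReal) < sigmaStar (fcs A b) lam q x) :
    ∃ σ' > σ, ∀ v : Euc n, (∀ i ∉ supp x, v i = 0) →
      2 * σ' * ‖v‖ ^ 2 ≤ inner ℝ (hessE A lam q (supp x) x v) v := by
  -- `sigmaStar` may be `⊤`, so a real number strictly in between is taken. The gap `σ' - σ` later
  -- pays for all Taylor errors.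
  obtain ⟨σ', h1, h2⟩ := EReal.lt_iff_exists_real_btwn.1 h
  refine ⟨σ', EReal.coe_lt_coe_iff.1 h1, fun v hv => ?_⟩
  rcases eq_or_ne v 0 with rfl | hv0
  · simp
  have hn : ‖v‖ ≠ 0 := norm_ne_zero_iff.2 hv0
  set u : Euc n := ‖v‖⁻¹ • v with hu
  have hus : ∀ i ∉ supp x, u i = 0 := fun i hi => by simp [hu, hv i hi]
  have hu1 : (fun j : supp x => u j) ⬝ᵥ (fun j : supp x => u j) = 1 := by
    rw [dotProduct, ← inner_eq_sum_of_supported u hus, real_inner_self_eq_norm_sq, hu, norm_smul,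
      norm_inv, norm_norm, inv_mul_cancel₀ hn, one_pow]
  have h3 : (σ' : EReal) < ((1 / 2 * inner ℝ (hessE A lam q (supp x) x u) u : ℝ) : EReal) := by
    refine h2.trans_le ?_
    rw [sigmaStar, genHessianE_fcs]
    refine (iInf₂_le _ (mem_singleton _)).trans ((iInf_le _ ⟨fun j : supp x => u j, hu1⟩).trans ?_)
    rw [inner_eq_sum_of_supported _ hus, dotProduct]
    simp_rw [hessian_submatrix_mulVec A b lam q ne_zero_of_mem_supp hus]
    exact le_rfl
  have h4 := EReal.coe_lt_coe_iff.1 h3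
  have h5 : v = ‖v‖ • u := by rw [hu, smul_smul, mul_inv_cancel₀ hn, one_smul]
  have h6 : inner ℝ (hessE A lam q (supp x) x v) v =
      ‖v‖ ^ 2 * inner ℝ (hessE A lam q (supp x) x u) u := by
    conv_lhs => rw [h5]
    rw [map_smul, inner_smul_left, inner_smul_right]
    simp; ring
  rw [h6]
  nlinarith [sq_nonneg ‖v‖]

theorem objE_compl (T : Finset (Fin n)) (y : Euc n) :
    objF (fcs A b) lam q y =
      objE (fcs A b) lam q T y + lam * ∑ i ∈ Tᶜ, absPow q (y i) := by
  rw [objF, objE, lqPow, lqPowOn, lqPowOn, ← Finset.sum_add_sum_compl T]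
  ring

theorem objF_eq_objE {T : Finset (Fin n)} {y : Euc n} (hy : ∀ i ∉ T, y i = 0) :
    objF (fcs A b) lam q y = objE (fcs A b) lam q T y := by
  rw [objE_compl A b lam q T, Finset.sum_eq_zero, mul_zero, add_zero]
  intro i hi
  rw [hy i (Finset.mem_compl.1 hi), absPow_zero_right]

theorem eq_zero_of_notMem_supp {x : Euc n} : ∀ i ∉ supp x, x i = 0 := fun i h => by
  simpa [supp] using h

/-- Quadratic growth of `F` at a stationary point with a uniformly positive definite Hessian on its
support. -/
theorem objF_growth {x : Euc n} {c : ℝ} (hlam : 0 < lam) (hq1 : q < 1) (hc : 0 < c)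
    (hpos : ∀ v : Euc n, (∀ i ∉ supp x, v i = 0) →
      2 * c * ‖v‖ ^ 2 ≤ inner ℝ (hessE A lam q (supp x) x v) v)
    (hstat : ∀ i ∈ supp x, gradE A b lam q (supp x) x i = 0) :
    ∀ᶠ y in 𝓝 x, objF (fcs A b) lam q x + c / 2 * ‖y - x‖ ^ 2 ≤ objF (fcs A b) lam q y := by
  set T := supp x with hT
  set g := gradE A b lam q T x
  set D := hessE A lam q T x
  -- The slope is chosen so that the off-support penalty absorbs the linear term (`‖g‖`), the
  -- Hessian terms involving the off-support part `v` (`‖D‖`), and still leaves `c * S ≥ c * ‖v‖²`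
  -- for the growth in `v`.
  have h1 : ∀ᶠ y in 𝓝 x, ∀ i ∈ Tᶜ, (‖g‖ + ‖D‖ + c) / lam * |y i| ≤ absPow q (y i) := by
    rw [Filter.eventually_all_finset]
    intro i hi
    have h := tendsto_coord i x
    rw [eq_zero_of_notMem_supp i (Finset.mem_compl.1 hi)] at h
    exact h.eventually (mul_abs_le_absPow_eventually hq1 _)
  have h2 : Tendsto (fun y : Euc n => (x, y)) (𝓝 x) (𝓝 (x, x)) :=
    (continuous_const.prodMk continuous_id).tendsto x
  filter_upwards [h1, h2.eventually (objE_taylor_two A b lam q (T := T) ne_zero_of_mem_supp hlam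
    (half_pos hc)), Metric.ball_mem_nhds x one_pos] with y hy1 hy2 hy3
  rw [mem_ball_iff_norm] at hy3
  set h := y - x with hh
  set u : Euc n := ∑ i ∈ T, h i • EuclideanSpace.single i (1 : ℝ) with hu
  set v : Euc n := ∑ i ∈ Tᶜ, h i • EuclideanSpace.single i (1 : ℝ) with hv
  have ui : ∀ i, u i = if i ∈ T then h i else 0 := fun i => by simp [hu, Pi.single_apply]
  have vi : ∀ i, v i = if i ∈ T then 0 else h i := fun i => by
    simp [hv, Pi.single_apply]
  have huv : h = u + v := by
    ext i; simp only [PiLp.add_apply, ui, vi]; split_ifs <;> simp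
  have huT : ∀ i ∉ T, u i = 0 := fun i hi => by simp [ui, hi]
  have hxT : ∀ i ∉ T, x i = 0 := eq_zero_of_notMem_supp
  have hgu : inner ℝ g u = 0 := by
    rw [inner_eq_sum_of_supported g huT]
    exact Finset.sum_eq_zero fun i _ => by rw [hstat i i.2, zero_mul]
  have huv0 : inner ℝ u v = 0 := by
    rw [real_inner_comm, inner_eq_sum_of_supported v huT]
    exact Finset.sum_eq_zero fun i _ => by simp [vi]
  have hnorm : ‖h‖ ^ 2 = ‖u‖ ^ 2 + ‖v‖ ^ 2 := by
    rw [huv, norm_add_sq_real, huv0]; ring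
  have hvS : ‖v‖ ≤ ∑ i ∈ Tᶜ, |y i| := by
    refine (norm_sum_le _ _).trans (Finset.sum_le_sum fun i hi => ?_)
    simp [norm_smul, hh, hxT i (Finset.mem_compl.1 hi)]
  set S := ∑ i ∈ Tᶜ, |y i|
  have hS : (‖g‖ + ‖D‖ + c) * S ≤ lam * ∑ i ∈ Tᶜ, absPow q (y i) := by
    have := Finset.sum_le_sum hy1
    rw [← Finset.mul_sum, div_mul_eq_mul_div, div_le_iff₀ hlam] at this
    linarith
  have hu1 : ‖u‖ ≤ 1 := by nlinarith [sq_nonneg ‖v‖, norm_nonneg h, norm_nonneg u]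
  have hv1 : ‖v‖ ≤ 1 := by nlinarith [sq_nonneg ‖u‖, norm_nonneg h, norm_nonneg v]
  have hgh : -(‖g‖ * S) ≤ inner ℝ g h := by
    rw [huv, inner_add_right, hgu, zero_add]
    have h5 := neg_le_of_abs_le (abs_real_inner_le_norm g v)
    have h6 : ‖g‖ * ‖v‖ ≤ ‖g‖ * S := by gcongr
    linarith
  have hD1 : |inner ℝ (D u) v| ≤ ‖D‖ * S := by
    refine (abs_real_inner_le_norm _ _).trans ?_
    have : ‖D u‖ ≤ ‖D‖ := (D.le_opNorm u).trans (mul_le_of_le_one_right (norm_nonneg _) hu1)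
    gcongr
  have hD2 : |inner ℝ (D v) h| ≤ ‖D‖ * S := by
    refine (abs_real_inner_le_norm _ _).trans ?_
    calc _ ≤ ‖D v‖ * 1 := by gcongr
      _ ≤ ‖D‖ * S := by rw [mul_one]; exact (D.le_opNorm v).trans (by gcongr)
  -- This splitting isolates the form on the support part `u` without appealing to symmetry of `D`.
  have hDD : inner ℝ (D h) h = inner ℝ (D u) u + inner ℝ (D u) v + inner ℝ (D v) h := by
    rw [← inner_add_right, ← huv, ← inner_add_left, ← map_add, ← huv]
  have hp := hpos u huT
  rw [objE_compl A b lam q T y, objF_eq_objE A b lam q hxT]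
  have e1 := (abs_le.1 hy2).1
  have e2 := (abs_le.1 hD1).1
  have e3 := (abs_le.1 hD2).1
  rw [hDD] at e1
  have e4 : ‖v‖ ^ 2 ≤ S := by nlinarith [norm_nonneg v]
  rw [hnorm] at e1 ⊢
  nlinarith

end

/-! ### The proximal phase and the Newton phase near a stationary point. -/

section

variable {m n : ℕ} {A : Matrix (Fin m) (Fin n) ℝ} {b : Euc m} {lam q : ℝ}

/-- The proximal objective is separable, so a competitor differing from `w` in one coordinate
isolates the scalar problem. -/
theorem prox_lqPow_coord {c : ℝ} {u w : Euc n} (h : w ∈ prox (fun z => c * lqPow q z) u)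
    (i : Fin n) (t : ℝ) :
    1 / 2 * (u i - w i) ^ 2 + c * absPow q (w i) ≤ 1 / 2 * (u i - t) ^ 2 + c * absPow q t := by
  have key : ∀ z : Euc n, 1 / 2 * ‖u - z‖ ^ 2 + c * lqPow q z =
      ∑ j, (1 / 2 * (u j - z j) ^ 2 + c * absPow q (z j)) := fun z => by
    rw [EuclideanSpace.real_norm_sq_eq, lqPow, lqPowOn, Finset.mul_sum, Finset.mul_sum,
      ← Finset.sum_add_distrib]
    rfl
  have h1 := h (WithLp.toLp 2 (Function.update w i t))
  rw [key, key, ← Finset.add_sum_erase _ _ (Finset.mem_univ i),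
    ← Finset.add_sum_erase _ _ (Finset.mem_univ i)] at h1
  have h2 : ∑ j ∈ Finset.univ.erase i, (1 / 2 * (u j - Function.update w i t j) ^ 2 +
      c * absPow q (Function.update w i t j)) =
      ∑ j ∈ Finset.univ.erase i, (1 / 2 * (u j - w j) ^ 2 + c * absPow q (w j)) :=
    Finset.sum_congr rfl fun j hj => by rw [Function.update_of_ne (Finset.ne_of_mem_erase hj)]
  simp only [h2, Function.update_self] at h1
  linarith

theorem prox_lqPow_stationary {c : ℝ} {u w : Euc n} (h : w ∈ prox (fun z => c * lqPow q z) u)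
    {i : Fin n} (hi : w i ≠ 0) : w i - u i + c * deriv (absPow q) (w i) = 0 := by
  have h1 : IsLocalMin (fun t => 1 / 2 * (u i - t) ^ 2 + c * absPow q t) (w i) :=
    .of_forall (prox_lqPow_coord h i)
  refine h1.hasDerivAt_eq_zero ?_
  have h2 := ((((hasDerivAt_id (w i)).const_sub (u i)).pow 2).const_mul (1 / 2 : ℝ)).add
    ((absPow_hasDerivAt q hi).const_mul c)
  refine h2.congr_deriv ?_
  simp

/-- Sufficient decrease in the proximal phase. -/
theorem prox_descent {σ σ₀ α : ℝ} (hσ₀ : StronglySmooth (fcs A b) σ₀) (hα0 : 0 < α)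
    (hα : α * (σ + σ₀) ≤ 1) {x w : Euc n}
    (h : w ∈ prox (fun z => α * lam * lqPow q z) (x - α • gradient (fcs A b) x)) :
    objF (fcs A b) lam q w + σ / 2 * ‖w - x‖ ^ 2 ≤ objF (fcs A b) lam q x := by
  -- With the competitor `x` the terms `½‖α g‖²` cancel. What remains, combined with `α` times the
  -- smoothness bound, leaves `½‖w - x‖²` to cover `α(σ + σ₀)/2 · ‖w - x‖²`.
  have h1 := h x
  have h2 := hσ₀ w x
  set g := gradient (fcs A b) x
  have e1 : x - α • g - w = -((w - x) + α • g) := by abel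
  have e2 : x - α • g - x = -(α • g) := by abel
  rw [e1, e2, norm_neg, norm_neg, norm_add_sq_real, inner_smul_right, real_inner_comm] at h1
  rw [objF, objF]
  have h3 : α * (fcs A b w + lam * lqPow q w + σ / 2 * ‖w - x‖ ^ 2) ≤
      α * (fcs A b x + lam * lqPow q x) := by
    nlinarith [mul_le_mul_of_nonneg_left h2 hα0.le,
      mul_le_mul_of_nonneg_right hα (sq_nonneg ‖w - x‖)]
  exact le_of_mul_le_mul_left h3 hα0

/-- Sufficient decrease in the Newton phase. -/
theorem NewtonPhase.descent {f : Euc n → ℝ} {σ γ : ℝ} {w x' : Euc n}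
    (h : NewtonPhase f lam q σ γ w x') :
    objF f lam q x' + σ / 2 * ‖x' - w‖ ^ 2 ≤ objF f lam q w := by
  obtain ⟨M, -, ⟨-, rfl⟩ | ⟨d, -, ⟨s, hs, rfl⟩ | ⟨-, rfl⟩⟩⟩ := h
  · simp
  · have h1 : objF f lam q (w - γ ^ s • d) ≤ objF f lam q w - σ / 2 * ‖γ ^ s • d‖ ^ 2 := hs.1
    have e : w - γ ^ s • d - w = -(γ ^ s • d) := by abel
    rw [e, norm_neg]
    linarith
  · simp

/-- The Newton phase does not enlarge the support. -/
theorem NewtonPhase.eq_zero_of_notMem {f : Euc n → ℝ} {σ γ : ℝ} {w x' : Euc n}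
    (h : NewtonPhase f lam q σ γ w x') : ∀ i ∉ supp w, x' i = 0 := by
  intro i hi
  have hw : w i = 0 := eq_zero_of_notMem_supp i hi
  obtain ⟨M, -, ⟨-, rfl⟩ | ⟨d, hd, ⟨s, hs, rfl⟩ | ⟨-, rfl⟩⟩⟩ := h
  · exact hw
  · simp [hw, hd.2 i hi]
  · exact hw

theorem newtonEq_iff {w d : Euc n} {M : Matrix (supp w) (supp w) ℝ}
    (hM : M ∈ genHessianE (fcs A b) lam q w) :
    NewtonEq (fcs A b) lam q w M d ↔
      (∀ i ∈ supp w, hessE A lam q (supp w) w d i = gradE A b lam q (supp w) w i) ∧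
        ∀ i ∉ supp w, d i = 0 := by
  rw [genHessianE_fcs] at hM
  subst hM
  refine and_congr_left fun hd => ?_
  rw [(objE_hasGradientAt A b lam q ne_zero_of_mem_supp).gradient]
  simp_rw [hessian_submatrix_mulVec A b lam q ne_zero_of_mem_supp hd]
  exact Subtype.forall

/-- The Newton equations are solvable where the Hessian is positive definite on the support. -/
theorem exists_newtonEq {w : Euc n} {M : Matrix (supp w) (supp w) ℝ}
    (hM : M ∈ genHessianE (fcs A b) lam q w)
    (hpos : ∀ v : Euc n, (∀ i ∉ supp w, v i = 0) →
      inner ℝ (hessE A lam q (supp w) w v) v ≤ 0 → v = 0) :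
    ∃ d, NewtonEq (fcs A b) lam q w M d := by
  rw [genHessianE_fcs] at hM
  let ext (v : supp w → ℝ) : Euc n :=
    WithLp.toLp 2 fun i => if h : i ∈ supp w then v ⟨i, h⟩ else 0
  have ext0 : ∀ v, ∀ i ∉ supp w, ext v i = 0 := fun v i hi => by simp [ext, hi]
  have extv : ∀ v, (fun j : supp w => ext v j) = v := fun v => by
    ext j; simp [ext]
  have hinj : Function.Injective M.mulVecLin := by
    rw [← LinearMap.ker_eq_bot, LinearMap.ker_eq_bot']
    intro v hv
    have h0 : ext v = 0 := by
      refine hpos _ (ext0 v) (le_of_eq ?_)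
      rw [inner_eq_sum_of_supported _ (ext0 v)]
      refine Finset.sum_eq_zero fun i _ => ?_
      rw [← hessian_submatrix_mulVec A b lam q ne_zero_of_mem_supp (ext0 v), extv, ← hM,
        ← Matrix.mulVecLin_apply, hv, Pi.zero_apply, zero_mul]
    rw [← extv v, h0]
    rfl
  obtain ⟨v, hv⟩ := LinearMap.injective_iff_surjective.1 hinj
    (fun i : supp w => gradient (objE (fcs A b) lam q (supp w)) w i)
  refine ⟨ext v, fun i => ?_, ext0 v⟩
  rw [extv]
  exact congrFun hv i

/-- Near a stationary point with a uniformly positive definite Hessian on its support, full Newton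
steps are taken and they contract quadratically (exactly onto the point if `q = 0`). -/
theorem newtonPhase_contraction {σ σ' γ : ℝ} {x : Euc n} (hlam : 0 < lam) (hσ : 0 < σ)
    (hσ' : σ < σ')
    (hpos : ∀ v : Euc n, (∀ i ∉ supp x, v i = 0) →
      2 * σ' * ‖v‖ ^ 2 ≤ inner ℝ (hessE A lam q (supp x) x v) v)
    (hstat : ∀ i ∈ supp x, gradE A b lam q (supp x) x i = 0) :
    ∃ C ≥ 0, (q = 0 → C = 0) ∧ ∀ᶠ w in 𝓝 x, supp w = supp x →
      ∀ x', NewtonPhase (fcs A b) lam q σ γ w x' → ‖x' - x‖ ≤ C * ‖w - x‖ ^ 2 := by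
  obtain ⟨C, hC0, hCq, hC⟩ :=
    gradE_newton_error A b lam q (T := supp x) (y := x) ne_zero_of_mem_supp hlam
  -- Two errors of size `ε‖d‖²` enter the acceptance test, and `-σ' + 2ε = -(σ' + σ)/2 < -σ/2`.
  have hε : 0 < (σ' - σ) / 4 := by linarith
  obtain ⟨r, hr, hE⟩ := Metric.eventually_nhds_iff_ball.1
    (objE_taylor_two A b lam q (T := supp x) (y := x) ne_zero_of_mem_supp hlam hε)
  have hsmall : Tendsto (fun w : Euc n => C / σ * ‖w - x‖ ^ 2) (𝓝 x) (𝓝 0) := by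
    have h : Continuous fun w : Euc n => C / σ * ‖w - x‖ ^ 2 := by fun_prop
    simpa using h.tendsto x
  refine ⟨C / σ, by positivity, fun h => by rw [hCq h, zero_div], ?_⟩
  filter_upwards [hC, abs_inner_hessE_sub_eventually_le A lam q (T := supp x) (y := x)
    ne_zero_of_mem_supp hε, hsmall.eventually_lt_const hr, Metric.ball_mem_nhds x hr]
    with w hw1 hw2 hw3 hw4 hsupp x' hN
  rw [← hsupp] at hpos hstat hE hw1 hw2
  set T := supp w with hT
  have hx : ∀ i ∉ T, x i = 0 := by rw [hsupp]; exact eq_zero_of_notMem_supp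
  have hwT : ∀ i ∉ T, w i = 0 := eq_zero_of_notMem_supp
  have hposw : ∀ v : Euc n, (∀ i ∉ T, v i = 0) →
      σ * ‖v‖ ^ 2 ≤ inner ℝ (hessE A lam q T w v) v := fun v hv => by
    have h1 := hpos v hv
    have h2 := (abs_le.1 (hw2 v)).1
    nlinarith [sq_nonneg ‖v‖]
  obtain ⟨M, hM, hN⟩ := hN
  have hsolv : ∃ d, NewtonEq (fcs A b) lam q w M d := exists_newtonEq hM fun v hv hv0 => by
    have h1 := (hposw v hv).trans hv0
    have h2 : ‖v‖ ^ 2 ≤ 0 := by nlinarith [sq_nonneg ‖v‖]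
    exact norm_eq_zero.1 (pow_eq_zero_iff two_ne_zero |>.1 (le_antisymm h2 (sq_nonneg _)))
  have step : ∀ d, NewtonEq (fcs A b) lam q w M d → ‖w - d - x‖ ≤ C / σ * ‖w - x‖ ^ 2 ∧
      NewtonAccept (fcs A b) lam q σ γ w d 0 := by
    intro d hd
    obtain ⟨hd1, hd2⟩ := (newtonEq_iff hM).1 hd
    have hdist : ‖w - d - x‖ ≤ C / σ * ‖w - x‖ ^ 2 := by
      set h : Euc n := w - d - x with hh
      have hhT : ∀ i ∉ T, h i = 0 := fun i hi => by simp [hh, hwT i hi, hx i hi, hd2 i hi]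
      -- On the support, `H_w d = ∇E(w)` and `∇E(x) = 0`, so `H_w (w - d - x)` is exactly the error
      -- of the Newton model.
      have e1 : inner ℝ (hessE A lam q T w h) h = inner ℝ (hessE A lam q T w (w - x) -
          (gradE A b lam q T w - gradE A b lam q T x)) h := by
        rw [inner_eq_sum_of_supported _ hhT, inner_eq_sum_of_supported _ hhT]
        refine Finset.sum_congr rfl fun i _ => ?_
        have : h = (w - x) - d := by rw [hh]; abel
        have h1 : hessE A lam q T w d i = gradE A b lam q T w i := hd1 i i.2
        rw [this, map_sub]
        simp only [PiLp.sub_apply, h1, hstat i i.2, sub_zero]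
      have e2 : σ * ‖h‖ ^ 2 ≤ C * ‖w - x‖ ^ 2 * ‖h‖ := by
        refine (hposw h hhT).trans ?_
        rw [e1]
        exact (real_inner_le_norm _ _).trans (by gcongr)
      rcases (norm_nonneg h).eq_or_lt with h0 | h0
      · rw [← h0]; positivity
      · have e3 : σ * ‖h‖ ≤ C * ‖w - x‖ ^ 2 := by
          refine le_of_mul_le_mul_right ?_ h0
          linarith
        rw [div_mul_eq_mul_div, le_div_iff₀ hσ]
        linarith
    refine ⟨hdist, ?_⟩
    -- The contraction estimate keeps the full step inside the ball where the two-point expansion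
    -- holds.
    have hy : w - d ∈ Metric.ball x r := by
      rw [mem_ball_iff_norm]; exact hdist.trans_lt hw3
    have hT2 := (abs_le.1 (hE (w, w - d) (by rw [← ball_prod_same]; exact ⟨hw4, hy⟩))).2
    have e1 : w - d - w = -d := by abel
    simp only [e1, map_neg, inner_neg_left, inner_neg_right, norm_neg, neg_neg] at hT2
    have e2 : inner ℝ (gradE A b lam q T w) d = inner ℝ (hessE A lam q T w d) d := by
      rw [inner_eq_sum_of_supported _ hd2, inner_eq_sum_of_supported _ hd2]
      exact Finset.sum_congr rfl fun i _ => by rw [hd1 i i.2]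
    have e3 := (abs_le.1 (hw2 d)).1
    have e4 := hpos d hd2
    rw [NewtonAccept, pow_zero, one_smul, objF_eq_objE A b lam q hwT,
      objF_eq_objE A b lam q (T := T) (y := w - d) fun i hi => by simp [hwT i hi, hd2 i hi]]
    nlinarith [sq_nonneg ‖d‖]
  rcases hN with ⟨h, -⟩ | ⟨d, hd, ⟨s, hs, rfl⟩ | ⟨h, -⟩⟩
  · exact absurd hsolv h
  · have hs0 : s = 0 := Nat.le_zero.1 (hs.2 (step d hd).2)
    rw [hs0, pow_zero, one_smul]
    exact (step d hd).1
  · exact absurd (step d hd).2 (h 0)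

/-- Points near `x` whose non-zero entries are bounded away from zero have the support of `x`. -/
theorem supp_eventually_eq (x : Euc n) {r : ℝ} (hr : 0 < r) :
    ∀ᶠ y in 𝓝 x, (∀ i, y i ≠ 0 → r ≤ |y i|) → supp y = supp x := by
  have h1 : ∀ᶠ y in 𝓝 x, ∀ i, x i = 0 → |y i| < r := by
    refine Filter.eventually_all.2 fun i => ?_
    by_cases hi : x i = 0
    · have h := (tendsto_coord i x).abs
      rw [hi, abs_zero] at h
      exact (h.eventually_lt_const hr).mono fun y hy _ => hy
    · exact .of_forall fun y h => absurd h hi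
  filter_upwards [h1, eventually_coord_ne_zero (T := supp x) ne_zero_of_mem_supp] with y hy1 hy2 hy
  ext i
  refine ⟨fun h => ?_, fun h => mem_supp.2 (hy2 i h)⟩
  rw [mem_supp] at h ⊢
  exact fun h0 => absurd (hy1 i h0) (not_lt.2 (hy i h))

/-- Quadratic upper bound for `F` on the subspace of the support of a stationary point. -/
theorem objF_upper {x : Euc n} (hlam : 0 < lam)
    (hstat : ∀ i ∈ supp x, gradE A b lam q (supp x) x i = 0) :
    ∃ C > 0, ∀ᶠ y in 𝓝 x, (∀ i ∉ supp x, y i = 0) →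
      objF (fcs A b) lam q y ≤ objF (fcs A b) lam q x + C * ‖y - x‖ ^ 2 := by
  set D := hessE A lam q (supp x) x
  refine ⟨‖D‖ + 1, by positivity, ?_⟩
  have h2 : Tendsto (fun y : Euc n => (x, y)) (𝓝 x) (𝓝 (x, x)) :=
    (continuous_const.prodMk continuous_id).tendsto x
  filter_upwards [h2.eventually (objE_taylor_two A b lam q (T := supp x) ne_zero_of_mem_supp hlam
    one_pos)] with y hy hyT
  have hxT : ∀ i ∉ supp x, x i = 0 := eq_zero_of_notMem_supp
  rw [objF_eq_objE A b lam q hyT, objF_eq_objE A b lam q hxT]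
  have e1 : inner ℝ (gradE A b lam q (supp x) x) (y - x) = 0 := by
    rw [inner_eq_sum_of_supported (S := supp x) _ fun i hi => by simp [hyT i hi, hxT i hi]]
    exact Finset.sum_eq_zero fun i _ => by rw [hstat i i.2, zero_mul]
  have e2 : inner ℝ (D (y - x)) (y - x) ≤ ‖D‖ * ‖y - x‖ ^ 2 := by
    rw [sq, ← mul_assoc]
    exact (real_inner_le_norm _ _).trans (by gcongr; exact D.le_opNorm _)
  have e3 := (abs_le.1 hy).2
  simp only [e1] at e3
  have e4 : 0 ≤ ‖D‖ * ‖y - x‖ ^ 2 := by positivity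
  linarith

theorem lqPow_nonneg (y : Euc n) : 0 ≤ lqPow q y := by
  rw [lqPow, lqPowOn]
  exact Finset.sum_nonneg fun i _ => absPow_nonneg q (y i)

theorem objF_nonneg (hlam : 0 < lam) (y : Euc n) : 0 ≤ objF (fcs A b) lam q y :=
  add_nonneg (fcs_nonneg A b y) (mul_nonneg hlam.le (lqPow_nonneg y))

end

/-! ### Convergence of abstract descent sequences. -/

/-- An antitone real sequence bounded below, and any sequence interlacing it, converge. -/
theorem exists_tendsto_of_interlaced {u v : ℕ → ℝ} (hu : ∀ k, 0 ≤ u k) (h1 : ∀ k, v k ≤ u k)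
    (h2 : ∀ k, u (k + 1) ≤ v k) :
    ∃ l, Tendsto u atTop (𝓝 l) ∧ Tendsto v atTop (𝓝 l) := by
  have ha : Antitone u := antitone_nat_of_succ_le fun k => (h2 k).trans (h1 k)
  have hb : BddBelow (range u) := ⟨0, by rintro _ ⟨k, rfl⟩; exact hu k⟩
  have hl := tendsto_atTop_ciInf ha hb
  exact ⟨_, hl, tendsto_of_tendsto_of_tendsto_of_le_of_le
    (hl.comp (tendsto_add_atTop_nat 1)) hl h2 h1⟩

theorem tendsto_of_sq_norm_le {E : Type*} [NormedAddCommGroup E] {c : ℝ} (hc : 0 < c)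
    {z : ℕ → E} {u : ℕ → ℝ} (hu : Tendsto u atTop (𝓝 0)) (h : ∀ᶠ k in atTop, c * ‖z k‖ ^ 2 ≤ u k) :
    Tendsto z atTop (𝓝 0) := by
  rw [tendsto_zero_iff_norm_tendsto_zero]
  have h1 : Tendsto (fun k => ‖z k‖ ^ 2) atTop (𝓝 0) := by
    refine squeeze_zero' (.of_forall fun k => sq_nonneg _) ?_ (g := fun k => u k / c)
      (by simpa using hu.div_const c)
    filter_upwards [h] with k hk
    rw [le_div_iff₀ hc]
    linarith
  simpa using h1.sqrt

/-- A descent sequence with vanishing steps converges to every cluster point at which the objective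
grows quadratically. -/
theorem tendsto_of_mapClusterPt_of_growth {E : Type*} [NormedAddCommGroup E] {F : E → ℝ} {a : E}
    {x : ℕ → E} {η : ℝ} (hη : 0 < η) (hg : ∀ᶠ y in 𝓝 a, F a + η * ‖y - a‖ ^ 2 ≤ F y)
    (hF : Tendsto (fun k => F (x k)) atTop (𝓝 (F a)))
    (hs : Tendsto (fun k => x (k + 1) - x k) atTop (𝓝 0)) (ha : MapClusterPt a atTop x) :
    Tendsto x atTop (𝓝 a) := by
  obtain ⟨r, hr, hg⟩ := Metric.eventually_nhds_iff_ball.1 hg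
  have h1 : ∀ᶠ k in atTop, F (x k) < F a + η * (r / 2) ^ 2 :=
    hF.eventually_lt_const (by have := mul_pos hη (sq_pos_of_pos (half_pos hr)); linarith)
  have h2 : ∀ᶠ k in atTop, ‖x (k + 1) - x k‖ < r / 2 := by
    have h := hs.norm
    rw [norm_zero] at h
    exact h.eventually_lt_const (half_pos hr)
  obtain ⟨N, hN⟩ := eventually_atTop.1 (h1.and h2)
  have h3 := ha.frequently (Metric.ball_mem_nhds a hr)
  obtain ⟨K, hK, hKr⟩ := (frequently_atTop.1 h3) N
  -- Inside the ball, growth and the small objective value force `‖x k - a‖ < r / 2`; a step shorter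
  -- than `r / 2` then cannot leave the ball.
  have hball : ∀ k ≥ K, x k ∈ Metric.ball a r := by
    intro k hk
    induction k, hk using Nat.le_induction with
    | base => exact hKr
    | succ k hk ih =>
      have e1 := hg _ ih
      obtain ⟨e2, e3⟩ := hN k (hK.trans hk)
      have e4 : ‖x k - a‖ < r / 2 := by
        refine lt_of_pow_lt_pow_left₀ 2 (by positivity) ?_
        refine lt_of_mul_lt_mul_left ?_ hη.le
        linarith
      rw [mem_ball_iff_norm]
      calc ‖x (k + 1) - a‖ = ‖(x (k + 1) - x k) + (x k - a)‖ := by rw [sub_add_sub_cancel]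
        _ ≤ _ := norm_add_le _ _
        _ < r := by linarith
  rw [← tendsto_sub_nhds_zero_iff]
  refine tendsto_of_sq_norm_le hη (u := fun k => F (x k) - F a) (by simpa using hF.sub_const (F a)) ?_
  filter_upwards [eventually_ge_atTop K] with k hk
  linarith [hg _ (hball k hk)]

/-! ### Stationarity of the limit and the main theorem. -/

section

variable {m n : ℕ} {A : Matrix (Fin m) (Fin n) ℝ} {b : Euc m} {lam q : ℝ}

/-- The proximal map keeps the non-zero entries bounded away from zero. -/
theorem exists_pos_le_abs_of_prox {c : ℝ} (hq1 : q < 1) (hc : 0 < c) :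
    ∃ r > 0, ∀ u w : Euc n, w ∈ prox (fun z => c * lqPow q z) u → ∀ i, w i ≠ 0 → r ≤ |w i| := by
  obtain ⟨r, hr, h⟩ := exists_pos_le_abs_of_scalar_prox hq1 hc
  exact ⟨r, hr, fun u w hw i hi => h (u i) (w i) hi (prox_lqPow_coord hw i)⟩

/-- Limits of proximal gradient steps of vanishing length are stationary. -/
theorem gradE_eq_zero_of_tendsto {α : ℝ} (hα0 : 0 < α) {x w : ℕ → Euc n} {a : Euc n}
    (hx : Tendsto x atTop (𝓝 a)) (hw : Tendsto w atTop (𝓝 a))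
    (hprox : ∀ k, w k ∈ prox (fun z => α * lam * lqPow q z)
      (x k - α • gradient (fcs A b) (x k))) :
    ∀ i ∈ supp a, gradE A b lam q (supp a) a i = 0 := by
  intro i hi
  have hai := ne_zero_of_mem_supp i hi
  have hwi := (tendsto_coord i a).comp hw
  have hxi := (tendsto_coord i a).comp hx
  have hgi := (tendsto_coord i _).comp (((continuous_fcsGrad A b).tendsto a).comp hx)
  have hdi := (deriv_absPow_contDiffAt q hai).continuousAt.tendsto.comp hwi
  have hlim := (hwi.sub (hxi.sub (hgi.const_mul α))).add (hdi.const_mul (α * lam))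
  have h0 := tendsto_nhds_unique_of_eventuallyEq hlim (tendsto_const_nhds (x := (0 : ℝ))) (by
    filter_upwards [hwi.eventually_ne hai] with k hk
    have := prox_lqPow_stationary (hprox k) hk
    rw [gradient_fcs] at this
    exact this)
  rw [gradE_apply_of_mem A b lam q hi]
  have h1 : α * (fcsGrad A b a i + lam * deriv (absPow q) (a i)) = 0 := by linarith
  exact (mul_eq_zero.1 h1).resolve_left hα0.ne'

end

theorem mainTheorem8 {m n : ℕ} (A : Matrix (Fin m) (Fin n) ℝ) (b : Euc m)
    (lam q : ℝ) (hlam : 0 < lam) (hq0 : 0 ≤ q) (hq1 : q < 1)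
    (σ γ τ α σ₀ : ℝ) (hσ : 0 < σ) (hγ0 : 0 < γ) (hγ1 : γ < 1) (hτ : 0 < τ)
    (hσ₀ : StronglySmooth (fcs A b) σ₀)
    (hα0 : 0 < α) (hα : α ≤ min τ (1 / (σ + σ₀)))
    (x w : ℕ → Euc n) (hrun : IsPSNPRun (fcs A b) lam q σ γ α x w)
    (xs : Euc n) (hxs : MapClusterPt xs atTop x)
    (hsoc : SecondOrderSufficient (fcs A b) lam q xs)
    (hσs : (σ : EReal) < sigmaStar (fcs A b) lam q xs) :
    Tendsto x atTop (𝓝 xs) ∧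
    (∃ η > 0, ∀ᶠ y in 𝓝 xs,
      objF (fcs A b) lam q xs + η * ‖y - xs‖ ^ 2 ≤ objF (fcs A b) lam q y) ∧
    (q = 0 → ∃ K, ∀ k ≥ K, x k = xs) ∧
    (0 < q → ∃ C, ∀ᶠ k in atTop, ‖x (k + 1) - xs‖ ≤ C * ‖x k - xs‖ ^ 2) := by
  have hα' : α * (σ + σ₀) ≤ 1 := by
    have h1 : α ≤ 1 / (σ + σ₀) := hα.trans (min_le_right _ _)
    -- Positivity of `σ + σ₀` follows from `0 < α ≤ 1 / (σ + σ₀)`.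
    exact (le_div_iff₀ (one_div_pos.1 (hα0.trans_le h1))).1 h1
  set F := objF (fcs A b) lam q with hF
  have hd1 : ∀ k, F (w k) + σ / 2 * ‖w k - x k‖ ^ 2 ≤ F (x k) := fun k =>
    prox_descent hσ₀ hα0 hα' (hrun.proximal k)
  have hd2 : ∀ k, F (x (k + 1)) + σ / 2 * ‖x (k + 1) - w k‖ ^ 2 ≤ F (w k) := fun k =>
    (hrun.newton k).descent
  have hp1 : ∀ k, 0 ≤ σ / 2 * ‖w k - x k‖ ^ 2 := fun k => by positivity
  have hp2 : ∀ k, 0 ≤ σ / 2 * ‖x (k + 1) - w k‖ ^ 2 := fun k => by positivity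
  obtain ⟨l, hxl, hwl⟩ := exists_tendsto_of_interlaced (u := fun k => F (x k))
    (v := fun k => F (w k)) (fun k => objF_nonneg hlam _) (fun k => by linarith [hd1 k, hp1 k])
    (fun k => by linarith [hd2 k, hp2 k])
  have hwx : Tendsto (fun k => w k - x k) atTop (𝓝 0) :=
    tendsto_of_sq_norm_le (half_pos hσ) (by simpa using hxl.sub hwl)
      (.of_forall fun k => by linarith [hd1 k])
  have hxw : Tendsto (fun k => x (k + 1) - w k) atTop (𝓝 0) :=
    tendsto_of_sq_norm_le (half_pos hσ)
      (by simpa using hwl.sub (hxl.comp (tendsto_add_atTop_nat 1)))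
      (.of_forall fun k => by simpa using by linarith [hd2 k])
  have hstep : Tendsto (fun k => x (k + 1) - x k) atTop (𝓝 0) := by
    simpa using hxw.add hwx
  obtain ⟨r, hr, hrw⟩ := exists_pos_le_abs_of_prox (n := n) hq1 (mul_pos hα0 hlam)
  have hsupp : ∀ᶠ y in 𝓝 xs, ∀ k, w k = y → supp (w k) = supp xs := by
    filter_upwards [supp_eventually_eq xs hr] with y hy k hk
    subst hk
    exact hy (hrw _ _ (hrun.proximal k))
  obtain ⟨ψ, hψ, hxψ⟩ := hxs.tendsto_subseq
  have hwψ : Tendsto (w ∘ ψ) atTop (𝓝 xs) := by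
    simpa [Function.comp_def] using (hwx.comp hψ.tendsto_atTop).add hxψ
  have hstat := gradE_eq_zero_of_tendsto hα0 hxψ hwψ fun k => hrun.proximal (ψ k)
  -- `F` need not be continuous at `xs`. The limit value is identified along `w ∘ ψ`, where the
  -- support is eventually that of `xs` and `F` agrees with the continuous `E(·; supp xs)`.
  have hl : l = F xs := by
    have hc : Tendsto (objE (fcs A b) lam q (supp xs)) (𝓝 xs)
        (𝓝 (objE (fcs A b) lam q (supp xs) xs)) :=
      (objE_hasGradientAt A b lam q ne_zero_of_mem_supp).differentiableAt.continuousAt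
    rw [hF, objF_eq_objE A b lam q (T := supp xs) eq_zero_of_notMem_supp]
    refine tendsto_nhds_unique_of_eventuallyEq (hwl.comp hψ.tendsto_atTop) (hc.comp hwψ) ?_
    filter_upwards [hwψ.eventually hsupp] with k hk
    have h := hk (ψ k) rfl
    exact objF_eq_objE A b lam q (h ▸ eq_zero_of_notMem_supp)
  rw [hl] at hxl
  obtain ⟨σ', hσ', hpos⟩ := exists_lt_forall_le_inner_hessE A b lam q hσs
  have hσ'0 : 0 < σ' := hσ.trans hσ'
  have hgrow := objF_growth A b lam q hlam hq1 hσ'0 hpos hstat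
  have hconv : Tendsto x atTop (𝓝 xs) :=
    tendsto_of_mapClusterPt_of_growth (half_pos hσ'0) hgrow hxl hstep hxs
  have hwconv : Tendsto w atTop (𝓝 xs) := by simpa using hwx.add hconv
  obtain ⟨C, hC0, hCq, hC⟩ := newtonPhase_contraction (γ := γ) hlam hσ hσ' hpos hstat
  have hnewton : ∀ᶠ k in atTop, ‖x (k + 1) - xs‖ ≤ C * ‖w k - xs‖ ^ 2 := by
    filter_upwards [hwconv.eventually hC, hwconv.eventually hsupp] with k hk hk'
    exact hk (hk' k rfl) _ (hrun.newton k)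
  refine ⟨hconv, ⟨σ' / 2, half_pos hσ'0, hgrow⟩, fun hq => ?_, fun _ => ?_⟩
  · obtain ⟨K, hK⟩ := eventually_atTop.1 hnewton
    refine ⟨K + 1, fun k hk => ?_⟩
    obtain ⟨j, rfl⟩ : ∃ j, k = j + 1 := ⟨k - 1, by omega⟩
    have h := hK j (by omega)
    rw [hCq hq, zero_mul] at h
    exact sub_eq_zero.1 (norm_le_zero_iff.1 h)
  · obtain ⟨U, hU0, hU⟩ := objF_upper (A := A) (b := b) hlam hstat
    -- `x k` inherits its zeros from `w (k - 1)`, hence the shift to `K + 1`.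
    have hxsupp : ∀ᶠ k in atTop, ∀ i ∉ supp xs, x k i = 0 := by
      obtain ⟨K, hK⟩ := eventually_atTop.1 (hwconv.eventually hsupp)
      filter_upwards [eventually_ge_atTop (K + 1)] with k hk
      obtain ⟨j, rfl⟩ : ∃ j, k = j + 1 := ⟨k - 1, by omega⟩
      exact hK j (by omega) j rfl ▸ (hrun.newton j).eq_zero_of_notMem
    -- `σ'/2 ‖wᵏ - x*‖² ≤ F(wᵏ) - F(x*) ≤ F(xᵏ) - F(x*) ≤ U ‖xᵏ - x*‖²`.
    refine ⟨C * (U / (σ' / 2)), ?_⟩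
    filter_upwards [hnewton, hxsupp, hconv.eventually hU, hwconv.eventually hgrow]
      with k h1 h2 h3 h4
    refine h1.trans ?_
    rw [mul_assoc]
    refine mul_le_mul_of_nonneg_left ?_ hC0
    rw [div_mul_eq_mul_div, le_div_iff₀ (half_pos hσ'0)]
    have h5 := h3 h2
    linarith [hd1 k, hp1 k]
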